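/- Let $v, v_1,v_2,\dots$ be i.i.d. nonnegative real random variables with $0<\mathbb E(v)<\infty$ (for instance heavy-tailed: Pareto, $\mathbb P(v>x)=(b/x)^a$ for $x\ge b$, with $a>1$, $b>0$, or Weibull, $\mathbb P(v>x)=e^{-(x/\eta)^\beta}$ for $x\ge 0$, with $\beta\in(0,1)$, $\eta>0$). Let $0<p<1$ and let $j\ge 0$ be an integer. For $K\ge 1$, consider an urn with $K$ colors, $v_i$ being the amount of balls with color $i$, and let $V=v_1+\cdots+v_K$. Given the environment $\mathcal F=\{v_i,\ 1\le i\le K\}$, a number $\lfloor pV\rfloor$ of balls are drawn independently with replacement, each of them having color $i$ with probability $v_i/V$. Let $\tilde v_i$ be the number of drawn balls with color $i$, let $W_j^+=\sum_{i=1}^K \mathbf 1_{\{\tilde v_i\ge j\}}$, and for $\lambda\ge 0$ let $Q_\lambda$ be a Poisson random variable with mean $\lambda$. Put $$X_j(p)=\sum_{\ell\ge j}\frac{(pv)^\ell}{\ell!}e^{-pv},\qquad m_j(p)=\mathbb E\big(X_j(p)\big),\qquad m_{2,j}(p)=\mathbb E\big(X_j(p)^2\big).$$ Then $m_j(p)>0$,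 the function $m_j$ is differentiable at $p$, and, for almost every environment $(v_i)_{i\ge 1}$, $$\limsup_{K\to\infty}\ \big\|\mathbb P(W_j^+\in\cdot\mid\mathcal F)-\mathbb P\big(Q_{\mathbb E(W_j^+\mid\mathcal F)}\in\cdot\big)\big\|_{tv}\ \le\ \frac{m_{2,j}(p)}{m_j(p)}+\frac{p}{\mathbb E(v)}\,\frac{m_j'(p)^2}{m_j(p)},$$ where $\|\mu-\nu\|_{tv}=\sup_{A\subset\mathbb N}|\mu(A)-\nu(A)|$ and $m_j'$ is the derivative of $m_j$ with respect to $p$. -/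

import Mathlib

open MeasureTheory ProbabilityTheory Filter

open scoped Nat

noncomputable section

namespace UrnSampling

/-- Total variation distance `sup_A |μ(A) - ν(A)|` between two laws on `ℕ`. -/
def tvDist (μ ν : Measure ℕ) : ℝ :=
  ⨆ A : Set ℕ, |μ.real A - ν.real A|

/-- The environment consists of `K` colors, color `i` having `w i` balls; this is the total number
`V` of balls. -/
def totalBalls {K : ℕ} (w : Fin K → ℝ) : ℝ :=
  ∑ i, w i

/-- The number of balls drawn: the fraction `p` of the total number of balls. -/
def numDraws {K : ℕ} (w : Fin K → ℝ) (p : ℝ) : ℕ :=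
  ⌊p * totalBalls w⌋₊

/-- The law of the color of one drawn ball: color `i` has probability `w i / V`. -/
def colorLaw {K : ℕ} (w : Fin K → ℝ) : Measure (Fin K) :=
  ∑ i, ENNReal.ofReal (w i / totalBalls w) • Measure.dirac i

/-- The law of the sequence of the colors of `n` balls drawn independently, with replacement. -/
def drawLaw {K : ℕ} (w : Fin K → ℝ) (n : ℕ) : Measure (Fin n → Fin K) :=
  Measure.pi fun _ => colorLaw w

/-- The number of drawn balls with color `i`. -/
def sampled {n K : ℕ} (c : Fin n → Fin K) (i : Fin K) : ℕ :=
  (Finset.univ.filter fun l => c l = i).card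

/-- `W_j^+`: the number of colors with at least `j` drawn balls. -/
def Wplus {n K : ℕ} (j : ℕ) (c : Fin n → Fin K) : ℕ :=
  (Finset.univ.filter fun i => j ≤ sampled c i).card

/-- The conditional law of `W_j^+` given that the environment is `w`. -/
def WplusLaw {K : ℕ} (w : Fin K → ℝ) (p : ℝ) (j : ℕ) : Measure ℕ :=
  (drawLaw w (numDraws w p)).map (Wplus j)

/-- The conditional mean of `W_j^+` given that the environment is `w`. -/
def WplusMean {K : ℕ} (w : Fin K → ℝ) (p : ℝ) (j : ℕ) : ℝ :=
  ∫ c, (Wplus j c : ℝ) ∂(drawLaw w (numDraws w p))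

/-- `X_j(p) = ∑_{ℓ ≥ j} (p x)^ℓ / ℓ! * exp (-p x)`, as a function of the number `x` of balls. -/
def poissonTail (j : ℕ) (p x : ℝ) : ℝ :=
  ∑' l : ℕ, (p * x) ^ (j + l) / ((j + l)! : ℝ) * Real.exp (-(p * x))

/-- The moment of order `r` of `X_j(p)` for a random number `v` of balls. -/
def tailMoment {Ω : Type*} [MeasurableSpace Ω] (μ : Measure Ω) (v : Ω → ℝ) (r j : ℕ) (p : ℝ) : ℝ :=
  ∫ ω, poissonTail j p (v ω) ^ r ∂μ

end UrnSampling

end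

/-! The argument is the Stein–Chen method for negatively related indicators. Write `W` for the
number of colors drawn at least `j` times, `λ` for its conditional mean and `q i = v_i / V`.
Increasing functions of one multinomial count and of the other counts are negatively correlated
(`multinomialExp_mul_le`). Combined with a solution of the Poisson Stein equation whose increments
are at most `1 / λ`, this bounds the total variation distance by `(λ - Var W) / λ`
(`multinomialExp_indicator_sub_le`).

The defect `λ - Var W` is `∑ π_i ^ 2` minus the off-diagonal covariances, where `π_i` is the
probability that color `i` is drawn at least `j` times. By `neg_cov_le` and `binomialOp_indGe_le`,
minus the covariance for colors `i ≠ k` is at most about `n q_i q_k φ(p v_i) φ(p v_k)`, where `n` is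
the number of draws and `φ = tailDensity j` is the derivative of the Poisson tail in its mean. The
total is about `(p / V) (∑ v_i φ(p v_i)) ^ 2` (`variance_defect_le`).

Le Cam's comparison replaces `π_i` by the Poisson tail at `p v_i`. After division by `K`, the strong
law turns every sum into a moment, and `E(v φ(p v))` is `m_j'(p)`. All corrections vanish because
the largest color probability tends to `0` (`tendsto_partialSups_div`). -/

noncomputable section

namespace UrnSampling

/-! ### Stein's method for the Poisson law -/

/-- The solution `f` of the Stein equation `r f(m+1) - m f(m) = a(m) - c` of a Poisson law with
weights `w`. -/
def steinSol (w a : ℕ → ℝ) (c : ℝ) (m : ℕ) : ℝ :=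
  (∑ k ∈ Finset.range m, (a k - c) * w k) / (m * w m)

theorem steinSol_eq {w : ℕ → ℝ} {r : ℝ} (a : ℕ → ℝ) (c : ℝ) (hw : ∀ k, 0 < w k)
    (hrec : ∀ k : ℕ, r * w k = (k + 1) * w (k + 1)) (hr : 0 < r) (m : ℕ) :
    r * steinSol w a c (m + 1) - m * steinSol w a c m = a m - c := by
  have h1 : r * steinSol w a c (m + 1)
      = (∑ k ∈ Finset.range (m + 1), (a k - c) * w k) / w m := by
    unfold steinSol
    push_cast
    rw [← hrec]
    have := (hw m).ne'
    field_simp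
  have h2 : m * steinSol w a c m = (∑ k ∈ Finset.range m, (a k - c) * w k) / w m := by
    unfold steinSol
    -- At `m = 0` the solution takes the value `0 / 0 = 0`, which is harmless: the Stein equation
    -- multiplies it by `0`.
    rcases Nat.eq_zero_or_pos m with rfl | hm
    · simp
    · have := (hw m).ne'
      have : (m : ℝ) ≠ 0 := by positivity
      field_simp
  rw [h1, h2, Finset.sum_range_succ]
  have := (hw m).ne'
  field_simp
  ring

theorem mul_sum_range_le {w : ℕ → ℝ} {r : ℝ} (hw : ∀ k, 0 < w k)
    (hrec : ∀ k : ℕ, r * w k = (k + 1) * w (k + 1)) (m : ℕ) :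
    r * ∑ k ∈ Finset.range m, w k ≤ m * ∑ k ∈ Finset.range (m + 1), w k := by
  rw [Finset.mul_sum, Finset.sum_range_succ', mul_add, Finset.mul_sum]
  have h : ∑ k ∈ Finset.range m, r * w k ≤ ∑ k ∈ Finset.range m, (m : ℝ) * w (k + 1) := by
    refine Finset.sum_le_sum fun k hk => ?_
    rw [hrec]
    have : k + 1 ≤ m := Finset.mem_range.1 hk
    have : (k : ℝ) + 1 ≤ m := by exact_mod_cast this
    exact mul_le_mul_of_nonneg_right this (hw _).le
  have := mul_nonneg (Nat.cast_nonneg (α := ℝ) m) (hw 0).le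
  linarith

/-- Termwise comparison of the two tails: the recursion turns `r * w (k + m)` into `(k + m + 1) * w
(k + m + 1)`, and `k + m + 1 ≥ m`. -/
theorem mul_one_sub_sum_range_le {w : ℕ → ℝ} {r : ℝ} (hw : ∀ k, 0 < w k)
    (hrec : ∀ k : ℕ, r * w k = (k + 1) * w (k + 1)) (hsum : HasSum w 1) (m : ℕ) :
    m * (1 - ∑ k ∈ Finset.range (m + 1), w k) ≤ r * (1 - ∑ k ∈ Finset.range m, w k) := by
  have h1 := hsum.summable.sum_add_tsum_nat_add (m + 1)
  have h2 := hsum.summable.sum_add_tsum_nat_add m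
  rw [hsum.tsum_eq] at h1 h2
  have e1 : 1 - ∑ k ∈ Finset.range (m + 1), w k = ∑' k, w (k + (m + 1)) := by linarith
  have e2 : 1 - ∑ k ∈ Finset.range m, w k = ∑' k, w (k + m) := by linarith
  have s1 : Summable fun k => w (k + (m + 1)) := (summable_nat_add_iff (m + 1)).2 hsum.summable
  have s2 : Summable fun k => w (k + m) := (summable_nat_add_iff m).2 hsum.summable
  rw [e1, e2, ← tsum_mul_left, ← tsum_mul_left]
  refine (s1.mul_left _).tsum_le_tsum (fun k => ?_) (s2.mul_left _)
  rw [hrec, ← add_assoc]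
  refine mul_le_mul_of_nonneg_right ?_ (hw _).le
  push_cast
  have : (0 : ℝ) ≤ k := Nat.cast_nonneg k
  linarith

/-- The increment is linear in the masses that `a` puts below, at and above `m`. The masses below
and above contribute nonpositively, by the tail and head inequalities; the mass at `m` is at most `w
m` and contributes at most `1 / r`. -/
theorem steinSol_sub_le {w a : ℕ → ℝ} {r c : ℝ} (hw : ∀ k, 0 < w k)
    (hrec : ∀ k : ℕ, r * w k = (k + 1) * w (k + 1)) (hr : 0 < r) (hsum : HasSum w 1)
    (ha0 : ∀ k, 0 ≤ a k) (ha1 : ∀ k, a k ≤ 1) (hc : HasSum (fun k => a k * w k) c)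
    {m : ℕ} (hm : 0 < m) :
    steinSol w a c (m + 1) - steinSol w a c m ≤ 1 / r := by
  have hm' : (0 : ℝ) < m := by positivity
  have hwm := hw m
  have hT := mul_one_sub_sum_range_le hw hrec hsum m
  have hS := mul_sum_range_le hw hrec m
  have e1 : steinSol w a c (m + 1)
      = (∑ k ∈ Finset.range (m + 1), (a k - c) * w k) / (r * w m) := by
    unfold steinSol
    push_cast
    rw [← hrec]
  have h0 : ∑ k ∈ Finset.range (m + 1), a k * w k ≤ c :=
    sum_le_hasSum _ (fun k _ => mul_nonneg (ha0 k) (hw k).le) hc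
  have hα : 0 ≤ ∑ k ∈ Finset.range m, a k * w k :=
    Finset.sum_nonneg fun k _ => mul_nonneg (ha0 k) (hw k).le
  have hδ : 0 ≤ a m * w m := mul_nonneg (ha0 m) hwm.le
  have hδ' : a m * w m ≤ w m := mul_le_of_le_one_left hwm.le (ha1 m)
  rw [e1]
  unfold steinSol
  simp only [sub_mul, Finset.sum_sub_distrib, ← Finset.mul_sum]
  rw [Finset.sum_range_succ] at hT hS h0 ⊢
  rw [Finset.sum_range_succ (n := m)]
  set A := ∑ k ∈ Finset.range m, a k * w k
  set S := ∑ k ∈ Finset.range m, w k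
  set d := a m * w m
  -- `A`, `d`, `b` are the masses below, at and above `m`.
  obtain ⟨b, hb, rfl⟩ : ∃ b, 0 ≤ b ∧ c = A + d + b := ⟨c - (A + d), by linarith, by ring⟩
  rw [div_sub_div _ _ (by positivity) (by positivity), div_le_div_iff₀ (by positivity) hr]
  have key : m * (A + d - (A + d + b) * (S + w m)) - r * (A - (A + d + b) * S) ≤ m * w m := by
    nlinarith [mul_le_mul_of_nonneg_left hT hα, mul_le_mul_of_nonneg_left hS hb,
      mul_le_mul_of_nonneg_left hS hδ, mul_le_mul_of_nonneg_left hδ' hm'.le]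
  have := mul_le_mul_of_nonneg_left key (mul_pos hr hwm).le
  nlinarith [this]

theorem poissonMeasure_weight_rec (r : NNReal) (k : ℕ) :
    (r : ℝ) * (poissonMeasure r).real {k} = (k + 1) * (poissonMeasure r).real {k + 1} := by
  rw [poissonMeasure_real_singleton, poissonMeasure_real_singleton, Nat.factorial_succ]
  push_cast
  have : (k ! : ℝ) ≠ 0 := by positivity
  field_simp
  ring

/-- Every indicator has a solution of the Poisson Stein equation whose increments, away from `0`,
are at most `1 / r`. -/
theorem exists_stein_solution (r : NNReal) (hr : 0 < r) (A : Set ℕ) :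
    ∃ f : ℕ → ℝ,
      (∀ m : ℕ, r * f (m + 1) - m * f m = A.indicator 1 m - (poissonMeasure r).real A) ∧
      ∀ m : ℕ, f (m + 2) - f (m + 1) ≤ 1 / r := by
  have hw : ∀ k, 0 < (poissonMeasure r).real {k} := fun k => poissonMeasure_real_singleton_pos k hr
  have hs : HasSum (fun k => (poissonMeasure r).real {k}) 1 := by
    simp_rw [poissonMeasure_real_singleton]
    exact hasSum_one_poissonMeasure r
  have hi : Integrable (A.indicator (1 : ℕ → ℝ)) (poissonMeasure r) :=
    (integrable_const (1 : ℝ)).indicator (MeasurableSet.of_discrete)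
  have hA : HasSum (fun k => A.indicator (1 : ℕ → ℝ) k * (poissonMeasure r).real {k})
      ((poissonMeasure r).real A) := by
    have := hasSum_integral_poissonMeasure hi
    rw [integral_indicator_one MeasurableSet.of_discrete] at this
    simpa only [poissonMeasure_real_singleton, smul_eq_mul, mul_comm] using this
  refine ⟨steinSol _ (A.indicator 1) _, fun m => steinSol_eq _ _ hw (poissonMeasure_weight_rec r)
    hr m, fun m => steinSol_sub_le hw (poissonMeasure_weight_rec r) hr hs ?_ ?_ hA m.succ_pos⟩
  · exact fun k => Set.indicator_nonneg (fun _ _ => zero_le_one) k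
  · exact fun k => Set.indicator_le_self' (fun _ _ => zero_le_one) k

/-! ### Expectations with respect to multinomial laws -/

/-- The number of colors with count at least `j`. -/
def countGe {ι : Type*} [Fintype ι] (j : ℕ) (x : ι → ℕ) : ℕ :=
  (Finset.univ.filter fun i => j ≤ x i).card

/-- The indicator of `[j, ∞)`. -/
def indGe (j m : ℕ) : ℝ := if j ≤ m then 1 else 0

theorem indGe_mono (j : ℕ) : Monotone (indGe j) := by
  intro a b hab
  unfold indGe
  split_ifs <;> first | omega | norm_num

theorem indGe_nonneg (j m : ℕ) : 0 ≤ indGe j m := by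
  unfold indGe; split_ifs <;> norm_num

theorem indGe_le_one (j m : ℕ) : indGe j m ≤ 1 := by
  unfold indGe; split_ifs <;> norm_num

theorem cast_countGe {ι : Type*} [Fintype ι] (j : ℕ) (x : ι → ℕ) :
    (countGe j x : ℝ) = ∑ i, indGe j (x i) := by
  simp [countGe, indGe, Finset.sum_boole]

section Multinomial

variable {ι : Type*} [Fintype ι] [DecidableEq ι]

/-- The expectation of `G(N)`, where `N i` is the number of times that `i` is drawn in `n`
independent draws with weights `q`. -/
def multinomialExp (q : ι → ℝ) : ℕ → ((ι → ℕ) → ℝ) → ℝ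
  | 0, G => G 0
  | n + 1, G => ∑ k, q k * multinomialExp q n fun x => G (x + Pi.single k 1)

variable {q : ι → ℝ}

theorem multinomialExp_succ (n : ℕ) (G : (ι → ℕ) → ℝ) :
    multinomialExp q (n + 1) G = ∑ k, q k * multinomialExp q n fun x => G (x + Pi.single k 1) :=
  rfl

theorem multinomialExp_add (n : ℕ) (G H : (ι → ℕ) → ℝ) :
    multinomialExp q n (fun x => G x + H x) = multinomialExp q n G + multinomialExp q n H := by
  induction n generalizing G H with
  | zero => rfl
  | succ n ih => simp only [multinomialExp_succ, ih, mul_add, Finset.sum_add_distrib]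

theorem multinomialExp_const_mul (n : ℕ) (a : ℝ) (G : (ι → ℕ) → ℝ) :
    multinomialExp q n (fun x => a * G x) = a * multinomialExp q n G := by
  induction n generalizing G with
  | zero => rfl
  | succ n ih => simp only [multinomialExp_succ, ih, Finset.mul_sum, mul_left_comm]

theorem multinomialExp_sub (n : ℕ) (G H : (ι → ℕ) → ℝ) :
    multinomialExp q n (fun x => G x - H x) = multinomialExp q n G - multinomialExp q n H := by
  have := multinomialExp_add (q := q) n (fun x => G x - H x) H
  simp only [sub_add_cancel] at this
  linarith

theorem multinomialExp_sum {κ : Type*} (s : Finset κ) (n : ℕ) (G : κ → (ι → ℕ) → ℝ) :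
    multinomialExp q n (fun x => ∑ k ∈ s, G k x) = ∑ k ∈ s, multinomialExp q n (G k) := by
  classical
  induction s using Finset.induction_on with
  | empty =>
    simpa using multinomialExp_const_mul (q := q) n 0 fun _ => 0
  | insert a s ha ih => simp only [Finset.sum_insert ha, multinomialExp_add, ih]

theorem multinomialExp_const (hq : ∑ k, q k = 1) (n : ℕ) (a : ℝ) :
    multinomialExp q n (fun _ => a) = a := by
  induction n with
  | zero => rfl
  | succ n ih => simp only [multinomialExp_succ, ih, ← Finset.sum_mul, hq, one_mul]

theorem multinomialExp_mono (hq : ∀ k, 0 ≤ q k) (n : ℕ) {G H : (ι → ℕ) → ℝ} (h : ∀ x, G x ≤ H x) :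
    multinomialExp q n G ≤ multinomialExp q n H := by
  induction n generalizing G H with
  | zero => exact h 0
  | succ n ih =>
    exact Finset.sum_le_sum fun k _ => mul_le_mul_of_nonneg_left (ih fun x => h _) (hq k)

theorem multinomialExp_succ_apply (hq : ∑ k, q k = 1) (i : ι) (n : ℕ) (f : ℕ → ℝ) :
    multinomialExp q (n + 1) (fun x => f (x i))
      = q i * multinomialExp q n (fun x => f (x i + 1))
        + (1 - q i) * multinomialExp q n (fun x => f (x i)) := by
  rw [multinomialExp_succ, ← Finset.add_sum_erase _ _ (Finset.mem_univ i), ← hq,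
    ← Finset.add_sum_erase _ q (Finset.mem_univ i), add_sub_cancel_left, Finset.sum_mul]
  congr 1
  · simp
  · refine Finset.sum_congr rfl fun k hk => ?_
    simp [Pi.single_eq_of_ne (Finset.ne_of_mem_erase hk).symm]

theorem multinomialExp_succ_apply₂ (hq : ∑ k, q k = 1) {i k : ι} (hik : i ≠ k) (n : ℕ)
    (F : ℕ → ℕ → ℝ) :
    multinomialExp q (n + 1) (fun x => F (x i) (x k))
      = q i * multinomialExp q n (fun x => F (x i + 1) (x k))
        + q k * multinomialExp q n (fun x => F (x i) (x k + 1))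
        + (1 - q i - q k) * multinomialExp q n (fun x => F (x i) (x k)) := by
  have hk : k ∈ Finset.univ.erase i := by simp [hik.symm]
  rw [multinomialExp_succ, ← Finset.add_sum_erase _ _ (Finset.mem_univ i),
    ← Finset.add_sum_erase _ _ hk, ← hq, ← Finset.add_sum_erase _ q (Finset.mem_univ i),
    ← Finset.add_sum_erase _ q hk, add_sub_cancel_left, add_sub_cancel_left, Finset.sum_mul,
    ← add_assoc]
  congr 1
  · simp [hik, hik.symm]
  · refine Finset.sum_congr rfl fun l hl => ?_
    rw [Finset.mem_erase, Finset.mem_erase] at hl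
    simp [Pi.single_eq_of_ne hl.1.symm, Pi.single_eq_of_ne hl.2.1.symm]

/-- Increasing functions of the count of one color and of the other counts are negatively
correlated. -/
theorem multinomialExp_mul_le (hq0 : ∀ k, 0 ≤ q k) (hq : ∑ k, q k = 1) (i : ι) (n : ℕ)
    {f : ℕ → ℝ} {h : (ι → ℕ) → ℝ} (hf : Monotone f) (hh : Monotone h)
    (hi : ∀ x, h (x + Pi.single i 1) = h x) :
    multinomialExp q n (fun x => f (x i) * h x)
      ≤ multinomialExp q n (fun x => f (x i)) * multinomialExp q n h := by
  induction n generalizing f h with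
  | zero => exact le_rfl
  | succ n ih =>
    have e1 : multinomialExp q (n + 1) (fun x => f (x i) * h x)
        = q i * multinomialExp q n (fun x => f (x i + 1) * h x)
          + ∑ k ∈ Finset.univ.erase i,
            q k * multinomialExp q n (fun x => f (x i) * h (x + Pi.single k 1)) := by
      rw [multinomialExp_succ, ← Finset.add_sum_erase _ _ (Finset.mem_univ i)]
      congr 1
      · simp [hi]
      · refine Finset.sum_congr rfl fun k hk => ?_
        simp [Pi.single_eq_of_ne (Finset.ne_of_mem_erase hk).symm]
    have e2 := multinomialExp_succ_apply hq i n f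
    have e3 : multinomialExp q (n + 1) h = q i * multinomialExp q n h
        + ∑ k ∈ Finset.univ.erase i, q k * multinomialExp q n (fun x => h (x + Pi.single k 1)) := by
      rw [multinomialExp_succ, ← Finset.add_sum_erase _ _ (Finset.mem_univ i)]
      simp only [hi]
    have hqe : ∑ k ∈ Finset.univ.erase i, q k = 1 - q i := by
      rw [← hq, ← Finset.add_sum_erase _ q (Finset.mem_univ i), add_sub_cancel_left]
    have hle : q i ≤ 1 := by
      have : 0 ≤ ∑ k ∈ Finset.univ.erase i, q k := Finset.sum_nonneg fun k _ => hq0 k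
      linarith
    set a := multinomialExp q n (fun x => f (x i))
    set a' := multinomialExp q n (fun x => f (x i + 1))
    set b := multinomialExp q n h
    set s := ∑ k ∈ Finset.univ.erase i, q k * multinomialExp q n (fun x => h (x + Pi.single k 1))
    have haa : a ≤ a' := multinomialExp_mono hq0 n fun x => hf (Nat.le_succ _)
    have hbs : (1 - q i) * b ≤ s := by
      rw [← hqe, Finset.sum_mul]
      refine Finset.sum_le_sum fun k _ => mul_le_mul_of_nonneg_left ?_ (hq0 k)
      exact multinomialExp_mono hq0 n fun x => hh (by simp)
    have i1 : multinomialExp q n (fun x => f (x i + 1) * h x) ≤ a' * b :=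
      ih (f := fun m => f (m + 1)) (fun x y hxy => hf (by omega)) hh hi
    have i2 : ∑ k ∈ Finset.univ.erase i,
        q k * multinomialExp q n (fun x => f (x i) * h (x + Pi.single k 1)) ≤ a * s := by
      rw [Finset.mul_sum]
      refine Finset.sum_le_sum fun k _ => ?_
      rw [mul_left_comm]
      refine mul_le_mul_of_nonneg_left
        (ih hf (fun x y hxy => hh (add_le_add_left hxy _)) fun x => ?_) (hq0 k)
      rw [add_right_comm, hi]
    rw [e1, e2, e3]
    have := mul_le_mul_of_nonneg_left i1 (hq0 i)
    -- Once `i1` and `i2` are used, the remaining slack is exactly `q i * (a' - a) * (s - (1 - q i)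
    -- * b)`.
    nlinarith [mul_nonneg (mul_nonneg (hq0 i) (sub_nonneg.2 haa)) (sub_nonneg.2 hbs)]

/-- For the number `W` of colors with count at least `j`, Stein's operator is controlled by the
defect of variance. -/
theorem stein_countGe_le (hq0 : ∀ k, 0 ≤ q k) (hq : ∑ k, q k = 1) (n j : ℕ) {g : ℕ → ℝ} {C : ℝ}
    (hg : ∀ m, g (m + 2) - g (m + 1) ≤ C) :
    multinomialExp q n (fun x => (countGe j x : ℝ))
          * multinomialExp q n (fun x => g (countGe j x + 1))
        - multinomialExp q n (fun x => countGe j x * g (countGe j x))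
      ≤ C * (multinomialExp q n (fun x => (countGe j x : ℝ))
          + multinomialExp q n (fun x => (countGe j x : ℝ)) ^ 2
          - multinomialExp q n (fun x => (countGe j x : ℝ) ^ 2)) := by
  set lam := multinomialExp q n (fun x => (countGe j x : ℝ)) with hlam
  -- The one-sided bound on the increments of `g` is precisely what makes `G` increasing, so that
  -- negative correlation applies to it.
  let G : ℕ → ℝ := fun m => C * m - g (m + 1)
  have hG : Monotone G := by
    refine monotone_nat_of_le_succ fun m => ?_
    have := hg m
    simp only [G]
    push_cast
    linarith
  -- `R i` counts the other colors, hence ignores `x i`; the full count is `R i + 1` when `j ≤ x i`.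
  let R : ι → (ι → ℕ) → ℕ := fun i x => ((Finset.univ.erase i).filter fun k => j ≤ x k).card
  have hR : ∀ i x, R i x ≤ countGe j x := fun i x =>
    Finset.card_le_card (Finset.filter_subset_filter _ (Finset.erase_subset _ _))
  have hRm : ∀ i, Monotone (R i) := fun i x y hxy =>
    Finset.card_le_card (Finset.monotone_filter_right _ fun k _ hk => le_trans hk (hxy k))
  have hRi : ∀ i x, R i (x + Pi.single i 1) = R i x := fun i x => by
    simp only [R]
    congr 1
    refine Finset.filter_congr fun k hk => ?_
    simp [Pi.single_eq_of_ne (Finset.ne_of_mem_erase hk)]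
  have hWR : ∀ i x, j ≤ x i → countGe j x = R i x + 1 := fun i x hx => by
    simp only [R, countGe]
    rw [Finset.filter_erase, Finset.card_erase_add_one]
    simpa using hx
  have key : ∀ i, multinomialExp q n
        (fun x => indGe j (x i) * (C * (countGe j x - 1) - g (countGe j x)))
      ≤ multinomialExp q n (fun x => indGe j (x i))
        * (C * lam - multinomialExp q n (fun x => g (countGe j x + 1))) := by
    intro i
    have h1 := multinomialExp_mul_le hq0 hq i n (indGe_mono j) (h := fun x => G (R i x))
      (fun x y hxy => hG (hRm i hxy)) (fun x => by rw [hRi])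
    have h2 : multinomialExp q n (fun x => G (R i x))
        ≤ C * lam - multinomialExp q n (fun x => g (countGe j x + 1)) := by
      rw [hlam, ← multinomialExp_const_mul, ← multinomialExp_sub]
      exact multinomialExp_mono hq0 n fun x => hG (hR i x)
    have h3 : 0 ≤ multinomialExp q n (fun x => indGe j (x i)) := by
      rw [← multinomialExp_const hq n (0 : ℝ)]
      exact multinomialExp_mono hq0 n fun x => indGe_nonneg _ _
    refine le_trans (le_of_eq ?_) (h1.trans (mul_le_mul_of_nonneg_left h2 h3))
    congr 1
    funext x
    by_cases hx : j ≤ x i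
    · simp [G, hWR i x hx]
    · simp [indGe, hx]
  -- Summing over `i` turns the indicators into the count itself.
  have hs := Finset.sum_le_sum fun i (_ : i ∈ Finset.univ) => key i
  rw [← multinomialExp_sum, ← Finset.sum_mul, ← multinomialExp_sum] at hs
  simp only [← Finset.sum_mul, ← cast_countGe] at hs
  rw [← hlam] at hs
  have e : multinomialExp q n
        (fun x => (countGe j x : ℝ) * (C * (countGe j x - 1) - g (countGe j x)))
      = C * multinomialExp q n (fun x => (countGe j x : ℝ) ^ 2) - C * lam
        - multinomialExp q n (fun x => countGe j x * g (countGe j x)) := by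
    rw [hlam, ← multinomialExp_const_mul, ← multinomialExp_const_mul, ← multinomialExp_sub,
      ← multinomialExp_sub]
    congr 1
    funext x
    ring
  rw [e] at hs
  linarith

theorem multinomialExp_indicator_compl (hq : ∑ k, q k = 1) (n : ℕ) (A : Set ℕ) (j : ℕ) :
    multinomialExp q n (fun x => Aᶜ.indicator (1 : ℕ → ℝ) (countGe j x))
      = 1 - multinomialExp q n (fun x => A.indicator (1 : ℕ → ℝ) (countGe j x)) := by
  rw [← multinomialExp_const hq n 1, ← multinomialExp_sub]
  congr 1
  funext x
  by_cases h : countGe j x ∈ A <;> simp [h]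

/-- The Stein equation for `A` identifies the deviation with the quantity bounded in
`stein_countGe_le` for `C = 1 / r`. This bounds it from above only; the lower bound is the upper
bound for the complement of `A`. -/
theorem multinomialExp_indicator_sub_le (hq0 : ∀ k, 0 ≤ q k) (hq : ∑ k, q k = 1) (n j : ℕ)
    {r : NNReal} (hr : 0 < r) (hmean : multinomialExp q n (fun x => (countGe j x : ℝ)) = r)
    (A : Set ℕ) :
    |multinomialExp q n (fun x => A.indicator (1 : ℕ → ℝ) (countGe j x))
        - (poissonMeasure r).real A|
      ≤ (r + (r : ℝ) ^ 2 - multinomialExp q n (fun x => (countGe j x : ℝ) ^ 2)) / r := by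
  have main : ∀ A : Set ℕ,
      multinomialExp q n (fun x => A.indicator (1 : ℕ → ℝ) (countGe j x))
          - (poissonMeasure r).real A
        ≤ (r + (r : ℝ) ^ 2 - multinomialExp q n (fun x => (countGe j x : ℝ) ^ 2)) / r := by
    intro A
    obtain ⟨f, hf, hf'⟩ := exists_stein_solution r hr A
    have h := stein_countGe_le hq0 hq n j hf'
    rw [hmean, ← multinomialExp_const_mul, ← multinomialExp_sub] at h
    simp only [hf] at h
    rw [multinomialExp_sub, multinomialExp_const hq] at h
    rwa [one_div_mul_eq_div] at h
  rw [abs_le]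
  refine ⟨?_, main A⟩
  have := main Aᶜ
  rw [multinomialExp_indicator_compl hq, probReal_compl_eq_one_sub
    MeasurableSet.of_discrete] at this
  linarith

end Multinomial

/-! ### Covariances of multinomial counts -/

/-- The `n`-th iterate of the operator `g ↦ u g + c g(· + 1)`. -/
def binomialOp (u c : ℝ) : ℕ → (ℕ → ℝ) → ℕ → ℝ
  | 0, g, x => g x
  | n + 1, g, x => u * binomialOp u c n g x + c * binomialOp u c n g (x + 1)

theorem binomialOp_shift (u c : ℝ) (n : ℕ) (g : ℕ → ℝ) (x : ℕ) :
    binomialOp u c n (fun m => g (m + 1)) x = binomialOp u c n g (x + 1) := by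
  induction n generalizing x with
  | zero => rfl
  | succ n ih => simp only [binomialOp, ih]

theorem binomialOp_nonneg {u c : ℝ} (hu : 0 ≤ u) (hc : 0 ≤ c) (n : ℕ) {g : ℕ → ℝ}
    (hg : ∀ m, 0 ≤ g m) (x : ℕ) : 0 ≤ binomialOp u c n g x := by
  induction n generalizing x with
  | zero => exact hg x
  | succ n ih => exact add_nonneg (mul_nonneg hu (ih x)) (mul_nonneg hc (ih _))

theorem binomialOp_le {u c c' : ℝ} (hu : 0 ≤ u) (hc : 0 ≤ c) (hcc : c ≤ c') (n : ℕ) {g : ℕ → ℝ}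
    (hg : ∀ m, 0 ≤ g m) (x : ℕ) : binomialOp u c n g x ≤ binomialOp u c' n g x := by
  induction n generalizing x with
  | zero => exact le_rfl
  | succ n ih =>
    exact add_le_add (mul_le_mul_of_nonneg_left (ih x) hu)
      (mul_le_mul hcc (ih _) (binomialOp_nonneg hu hc n hg _) (hc.trans hcc))

theorem binomialOp_zero (u c : ℝ) (n x : ℕ) : binomialOp u c n (fun _ => 0) x = 0 := by
  induction n generalizing x with
  | zero => rfl
  | succ n ih => simp only [binomialOp, ih, mul_zero, add_zero]

theorem pow_succ_add_le (n : ℝ) (hn : 0 ≤ n) (d : ℕ) :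
    n ^ (d + 1) + (d + 1) * n ^ d ≤ (n + 1) ^ (d + 1) := by
  induction d with
  | zero => simp
  | succ d ih =>
    have h1 := mul_le_mul_of_nonneg_right ih (by linarith : 0 ≤ n + 1)
    have h2 : 0 ≤ ((d : ℝ) + 1) * n ^ d := by positivity
    rw [pow_succ (n + 1) (d + 1)]
    refine le_trans (le_trans (le_of_eq ?_) (sub_le_self _ h2)) h1
    push_cast
    ring

theorem binomialOp_single_eq_zero (u c : ℝ) (n : ℕ) {α x : ℕ} (hx : α < x) :
    binomialOp u c n (fun m => if m = α then 1 else 0) x = 0 := by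
  induction n generalizing x with
  | zero => simp [binomialOp, hx.ne']
  | succ n ih => simp [binomialOp, ih hx, ih (hx.trans x.lt_succ_self)]

/-- The left side is a binomial term `C(n, d) u ^ (n - d) (u c) ^ d`, and `C(n, d) ≤ n ^ d / d!`.
Writing the shift weight as `u * c` restores the full power `u ^ n`. -/
theorem binomialOp_single_le {u c : ℝ} (hu : 0 ≤ u) (hc : 0 ≤ c) (n d : ℕ) {α x : ℕ}
    (hx : x + d = α) :
    binomialOp u (u * c) n (fun m => if m = α then 1 else 0) x ≤ u ^ n * ((n * c) ^ d / d !) := by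
  induction n generalizing x d with
  | zero =>
    rcases Nat.eq_zero_or_pos d with rfl | hd
    · simp [binomialOp]; split_ifs <;> norm_num
    · have : x ≠ α := by omega
      simp [binomialOp, this, hd.ne']
  | succ n ih =>
    rcases d with _ | d
    · have h0 : binomialOp u (u * c) n (fun m => if m = α then 1 else 0) (x + 1) = 0 :=
        binomialOp_single_eq_zero _ _ _ (by omega)
      have h1 := mul_le_mul_of_nonneg_left (ih 0 hx) hu
      simp only [binomialOp, h0, mul_zero, add_zero]
      refine h1.trans (le_of_eq ?_)
      simp [pow_succ, mul_comm]
    · have h1 := mul_le_mul_of_nonneg_left (ih (d + 1) hx) hu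
      have h2 := mul_le_mul_of_nonneg_left (ih d (x := x + 1) (by omega)) (mul_nonneg hu hc)
      have h3 := pow_succ_add_le (n : ℝ) (Nat.cast_nonneg n) d
      refine (add_le_add h1 h2).trans ?_
      have e : u * (u ^ n * ((n * c) ^ (d + 1) / ((d + 1)! : ℝ)))
          + u * c * (u ^ n * ((n * c) ^ d / (d ! : ℝ)))
          = u ^ (n + 1) * c ^ (d + 1) / ((d + 1)! : ℝ)
            * ((n : ℝ) ^ (d + 1) + (d + 1) * (n : ℝ) ^ d) := by
        rw [Nat.factorial_succ]
        push_cast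
        have : (d ! : ℝ) ≠ 0 := by positivity
        field_simp
        ring
      rw [e]
      refine (mul_le_mul_of_nonneg_left h3 (by positivity)).trans (le_of_eq ?_)
      push_cast
      rw [mul_pow]
      ring

section Multinomial

variable {ι : Type*} [Fintype ι] [DecidableEq ι] {q : ι → ℝ}

theorem multinomialExp_apply (hq : ∑ k, q k = 1) (i : ι) (n : ℕ) (f : ℕ → ℝ) :
    multinomialExp q n (fun x => f (x i)) = binomialOp (1 - q i) (q i) n f 0 := by
  induction n generalizing f with
  | zero => rfl
  | succ n ih =>
    rw [multinomialExp_succ_apply hq, ih f, ih fun m => f (m + 1), binomialOp_shift, binomialOp,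
      add_comm]

theorem add_le_one_of_sum (hq0 : ∀ k, 0 ≤ q k) (hq : ∑ k, q k = 1) {i k : ι} (hik : i ≠ k) :
    q i + q k ≤ 1 := by
  rw [← hq, ← Finset.sum_pair hik]
  exact Finset.sum_le_univ_sum_of_nonneg hq0

/-- An upper bound for minus the covariance of increasing functions of two counts. -/
theorem neg_cov_le (hq0 : ∀ k, 0 ≤ q k) (hq : ∑ k, q k = 1) {i k : ι} (hik : i ≠ k)
    (hi : q i < 1) (hk : q k < 1) (n : ℕ) {f h : ℕ → ℝ} (hf : Monotone f) (hh : Monotone h) :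
    (1 - q i) * (1 - q k) *
        (multinomialExp q n (fun x => f (x i)) * multinomialExp q n (fun x => h (x k))
          - multinomialExp q n (fun x => f (x i) * h (x k)))
      ≤ n * (q i * q k) *
        (binomialOp (1 - q i) (q i / (1 - q k)) n (fun m => f (m + 1) - f m) 0
          * binomialOp (1 - q k) (q k / (1 - q i)) n (fun m => h (m + 1) - h m) 0) := by
  have hu : 0 < 1 - q i := by linarith
  have hw : 0 < 1 - q k := by linarith
  induction n generalizing f h with
  | zero => simp [multinomialExp]
  | succ n ih =>
    have hf' : Monotone fun m => f (m + 1) := fun x y hxy => hf (by omega)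
    have hh' : Monotone fun m => h (m + 1) := fun x y hxy => hh (by omega)
    have hdf : ∀ m, 0 ≤ f (m + 1) - f m := fun m => sub_nonneg.2 (hf (Nat.le_succ m))
    have hdh : ∀ m, 0 ≤ h (m + 1) - h m := fun m => sub_nonneg.2 (hh (Nat.le_succ m))
    have i10 := ih hf' hh
    have i01 := ih hf hh'
    have i00 := ih hf hh
    rw [binomialOp_shift (1 - q i) _ n (fun m => f (m + 1) - f m)] at i10
    rw [binomialOp_shift (1 - q k) _ n (fun m => h (m + 1) - h m)] at i01
    -- The true marginal has shift weight `q i`; enlarging it to `q i / (1 - q k)` is what lets the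
    -- induction close.
    have hci : q i ≤ q i / (1 - q k) := le_div_self (hq0 i) hw (by linarith [hq0 k])
    have hck : q k ≤ q k / (1 - q i) := le_div_self (hq0 k) hu (by linarith [hq0 i])
    have ha : multinomialExp q n (fun x => f (x i + 1)) - multinomialExp q n (fun x => f (x i))
        ≤ binomialOp (1 - q i) (q i / (1 - q k)) n (fun m => f (m + 1) - f m) 0 := by
      rw [← multinomialExp_sub, multinomialExp_apply hq i n fun m => f (m + 1) - f m]
      exact binomialOp_le hu.le (hq0 i) hci n hdf 0
    have hb : multinomialExp q n (fun x => h (x k + 1)) - multinomialExp q n (fun x => h (x k))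
        ≤ binomialOp (1 - q k) (q k / (1 - q i)) n (fun m => h (m + 1) - h m) 0 := by
      rw [← multinomialExp_sub, multinomialExp_apply hq k n fun m => h (m + 1) - h m]
      exact binomialOp_le hw.le (hq0 k) hck n hdh 0
    have hb0 : 0 ≤ multinomialExp q n (fun x => h (x k + 1))
        - multinomialExp q n (fun x => h (x k)) :=
      sub_nonneg.2 (multinomialExp_mono hq0 n fun x => hh (Nat.le_succ _))
    rw [multinomialExp_succ_apply hq, multinomialExp_succ_apply hq,
      multinomialExp_succ_apply₂ hq hik n fun a b => f a * h b]
    simp only [binomialOp]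
    have hX := binomialOp_nonneg hu.le ((hq0 i).trans hci) n hdf
    have hY := binomialOp_nonneg hw.le ((hq0 k).trans hck) n hdh
    have hX0 := hX 0
    have hX1 := hX 1
    have hY0 := hY 0
    have hY1 := hY 1
    simp only [zero_add] at i10 i01 ⊢
    set X := binomialOp (1 - q i) (q i / (1 - q k)) n (fun m => f (m + 1) - f m) 0
    set X' := binomialOp (1 - q i) (q i / (1 - q k)) n (fun m => f (m + 1) - f m) 1
    set Y := binomialOp (1 - q k) (q k / (1 - q i)) n (fun m => h (m + 1) - h m) 0
    set Y' := binomialOp (1 - q k) (q k / (1 - q i)) n (fun m => h (m + 1) - h m) 1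
    set a := multinomialExp q n (fun x => f (x i))
    set a' := multinomialExp q n (fun x => f (x i + 1))
    set b := multinomialExp q n (fun x => h (x k))
    set b' := multinomialExp q n (fun x => h (x k + 1))
    set e00 := multinomialExp q n (fun x => f (x i) * h (x k))
    set e10 := multinomialExp q n (fun x => f (x i + 1) * h (x k))
    set e01 := multinomialExp q n (fun x => f (x i) * h (x k + 1))
    have hr : 0 ≤ 1 - q i - q k := by linarith [add_le_one_of_sum hq0 hq hik]
    have hqi := hq0 i
    have hqk := hq0 k
    have hqq := mul_nonneg hqi hqk
    have hab : (a' - a) * (b' - b) ≤ X * Y := mul_le_mul ha hb hb0 hX0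
    -- The denominators are chosen so that the mixed terms `X * Y'` and `X' * Y` get the
    -- coefficients `q k` and `q i`, the same as in the recursion of the covariance.
    have eXY : ((1 - q i) * X + q i / (1 - q k) * X') * ((1 - q k) * Y + q k / (1 - q i) * Y')
        = (1 - q i) * (1 - q k) * (X * Y) + q k * (X * Y') + q i * (X' * Y)
          + q i * q k / ((1 - q i) * (1 - q k)) * (X' * Y') := by
      field_simp
      ring
    rw [eXY]
    have p1 := mul_nonneg hX0 hY0
    have p2 := mul_nonneg hX0 hY1
    have p3 := mul_nonneg hX1 hY0
    have p4 : 0 ≤ q i * q k / ((1 - q i) * (1 - q k)) * (X' * Y') := by positivity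
    set Z := q i * q k / ((1 - q i) * (1 - q k)) * (X' * Y')
    set U := (1 - q i) * (1 - q k) with hU
    have hU0 : 0 < U := mul_pos hu hw
    have hUr : 1 - q i - q k ≤ U := by nlinarith
    have t1 := mul_le_mul_of_nonneg_left i10 (hq0 i)
    have t2 := mul_le_mul_of_nonneg_left i01 (hq0 k)
    have t3 := mul_le_mul_of_nonneg_left i00 hr
    have t4 := mul_le_mul_of_nonneg_left hab (mul_nonneg hU0.le hqq)
    have hN : 0 ≤ (n : ℝ) * (q i * q k) := by positivity
    have t5 := mul_le_mul_of_nonneg_left (mul_le_mul_of_nonneg_right hUr p1) hN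
    have t6 := mul_nonneg hN p4
    have t7 : 0 ≤ q i * q k * (q k * (X * Y') + q i * (X' * Y) + Z) := by positivity
    push_cast
    -- Conditioning on one draw mixes the three earlier covariances and adds `q i * q k * (a' - a) *
    -- (b' - b)`; this new term pays for passing from `n` to `n + 1` in the bound.
    calc U * ((q i * a' + (1 - q i) * a) * (q k * b' + (1 - q k) * b)
            - (q i * e10 + q k * e01 + (1 - q i - q k) * e00))
        = q i * (U * (a' * b - e10)) + q k * (U * (a * b' - e01))
            + (1 - q i - q k) * (U * (a * b - e00)) + U * (q i * q k) * ((a' - a) * (b' - b)) := by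
          ring
      _ ≤ q i * (n * (q i * q k) * (X' * Y)) + q k * (n * (q i * q k) * (X * Y'))
            + (1 - q i - q k) * (n * (q i * q k) * (X * Y)) + U * (q i * q k) * (X * Y) := by
          linarith
      _ ≤ _ := by linarith

end Multinomial

/-- The density `a ^ (j - 1) / (j - 1)! * exp (-a)` of the `Γ(j, 1)` law, with value `0` for
`j = 0`. -/
def tailDensity : ℕ → ℝ → ℝ
  | 0, _ => 0
  | j + 1, a => a ^ j / (j ! : ℝ) * Real.exp (-a)

theorem tailDensity_nonneg (j : ℕ) {a : ℝ} (ha : 0 ≤ a) : 0 ≤ tailDensity j a := by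
  rcases j with _ | j
  · exact le_rfl
  · unfold tailDensity; positivity

/-- The increment of the indicator is a point mass at `j - 1`, so a nearly binomial weight is
compared with a Poisson one. The window for `a` absorbs the rounding of the number of draws and
costs `exp ε`; the enlarged success weight costs the power of `(1 - ε)⁻²`. -/
theorem binomialOp_indGe_le {x y ε a : ℝ} (hx0 : 0 ≤ x) (hxε : x ≤ ε) (hyε : y ≤ ε)
    (hε : ε < 1) (n j : ℕ) (h1 : n * x ≤ a) (h2 : a ≤ n * x + x) :
    binomialOp (1 - x) (x / (1 - y)) n (fun m => indGe j (m + 1) - indGe j m) 0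
      ≤ Real.exp ε * (((1 - ε) ^ 2)⁻¹) ^ j * tailDensity j a := by
  have hu : 0 < 1 - x := by linarith
  have hw : 0 < 1 - y := by linarith
  have hv : 0 < 1 - ε := by linarith
  rcases j with _ | α
  · have : (fun m => indGe 0 (m + 1) - indGe 0 m) = fun _ => (0 : ℝ) := by
      funext m; simp [indGe]
    rw [this, tailDensity, mul_zero]
    exact (binomialOp_zero _ _ n 0).le
  · have : (fun m => indGe (α + 1) (m + 1) - indGe (α + 1) m)
        = fun m => if m = α then (1 : ℝ) else 0 := by
      funext m
      unfold indGe
      split_ifs <;> first | omega | norm_num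
    rw [this]
    have hc : x / (1 - y) = (1 - x) * (x / ((1 - x) * (1 - y))) := by field_simp
    rw [hc]
    refine (binomialOp_single_le hu.le (by positivity) n α (zero_add α)).trans ?_
    have b1 : (1 - x) ^ n ≤ Real.exp ε * Real.exp (-a) := by
      rw [← Real.exp_add]
      calc (1 - x) ^ n ≤ Real.exp (-x) ^ n :=
            pow_le_pow_left₀ hu.le (by linarith [Real.add_one_le_exp (-x)]) n
        _ = Real.exp (-(n * x)) := by rw [← Real.exp_nat_mul]; ring_nf
        _ ≤ _ := Real.exp_le_exp.2 (by linarith)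
    have b2 : n * (x / ((1 - x) * (1 - y))) ≤ ((1 - ε) ^ 2)⁻¹ * a := by
      rw [mul_div_assoc', div_eq_inv_mul]
      refine mul_le_mul (inv_anti₀ (by positivity) ?_) h1 (by positivity) (by positivity)
      rw [sq]
      exact mul_le_mul (by linarith) (by linarith) hv.le hu.le
    have ha : 0 ≤ a := le_trans (by positivity) h1
    have b3 : (1 : ℝ) ≤ ((1 - ε) ^ 2)⁻¹ :=
      (one_le_inv₀ (by positivity)).2 (pow_le_one₀ hv.le (by linarith))
    calc (1 - x) ^ n * ((n * (x / ((1 - x) * (1 - y)))) ^ α / (α ! : ℝ))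
        ≤ (Real.exp ε * Real.exp (-a)) * ((((1 - ε) ^ 2)⁻¹ * a) ^ α / (α ! : ℝ)) := by
          gcongr
      _ = Real.exp ε * ((1 - ε) ^ 2)⁻¹ ^ α * tailDensity (α + 1) a := by
          rw [mul_pow, tailDensity]; ring
      _ ≤ _ := by
          have := tailDensity_nonneg (α + 1) ha
          gcongr
          exact α.le_succ

/-! ### The variance defect of the number of colors. -/

section Multinomial

variable {ι : Type*} [Fintype ι] [DecidableEq ι] {q : ι → ℝ}

theorem multinomialExp_countGe (n j : ℕ) :
    multinomialExp q n (fun x => (countGe j x : ℝ))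
      = ∑ i, multinomialExp q n (fun x => indGe j (x i)) := by
  simp only [cast_countGe, multinomialExp_sum]

theorem variance_defect_le (hq0 : ∀ k, 0 ≤ q k) (hq : ∑ k, q k = 1) {ε : ℝ} (hε : ε < 1)
    (hqε : ∀ k, q k ≤ ε) (n j : ℕ) {a : ι → ℝ} (h1 : ∀ i, n * q i ≤ a i)
    (h2 : ∀ i, a i ≤ n * q i + q i) :
    multinomialExp q n (fun x => (countGe j x : ℝ))
        + multinomialExp q n (fun x => (countGe j x : ℝ)) ^ 2
        - multinomialExp q n (fun x => (countGe j x : ℝ) ^ 2)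
      ≤ ∑ i, multinomialExp q n (fun x => indGe j (x i)) ^ 2
        + n * (((1 - ε) ^ 2)⁻¹ * (Real.exp ε * (((1 - ε) ^ 2)⁻¹) ^ j) ^ 2)
          * (∑ i, q i * tailDensity j (a i)) ^ 2 := by
  have hv : 0 < 1 - ε := by linarith
  have ha : ∀ i, 0 ≤ a i := fun i => le_trans (mul_nonneg (Nat.cast_nonneg n) (hq0 i)) (h1 i)
  set B := Real.exp ε * (((1 - ε) ^ 2)⁻¹) ^ j with hB
  set t : ι → ℝ := fun i => q i * tailDensity j (a i) with ht
  have ht0 : ∀ i, 0 ≤ t i := fun i => mul_nonneg (hq0 i) (tailDensity_nonneg j (ha i))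
  set π : ι → ℝ := fun i => multinomialExp q n (fun x => indGe j (x i)) with hπ
  -- On the diagonal the covariance is exact, and its `-π i` will cancel the mean. The nonnegative
  -- product term is kept there too, so that the double sum is a full square.
  have hpair : ∀ i k, π i * π k - multinomialExp q n (fun x => indGe j (x i) * indGe j (x k))
      ≤ (if i = k then π i ^ 2 - π i else 0) + n * (((1 - ε) ^ 2)⁻¹ * B ^ 2) * (t i * t k) := by
    intro i k
    have hpos : 0 ≤ n * (((1 - ε) ^ 2)⁻¹ * B ^ 2) * (t i * t k) := by
      have := mul_nonneg (ht0 i) (ht0 k)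
      positivity
    by_cases hik : i = k
    · subst hik
      have : (fun x : ι → ℕ => indGe j (x i) * indGe j (x i)) = fun x => indGe j (x i) := by
        funext x; unfold indGe; split_ifs <;> norm_num
      rw [this, if_pos rfl]
      have : multinomialExp q n (fun x => indGe j (x i)) = π i := rfl
      rw [this]
      nlinarith
    · rw [if_neg hik, zero_add]
      have hlt : ∀ l, q l < 1 := fun l => (hqε l).trans_lt hε
      have h := neg_cov_le hq0 hq hik (hlt i) (hlt k) n (indGe_mono j) (indGe_mono j)
      have hu : 0 < 1 - q i := by linarith [hlt i]
      have hw : 0 < 1 - q k := by linarith [hlt k]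
      have hX := binomialOp_indGe_le (hq0 i) (hqε i) (hqε k) hε n j (h1 i) (h2 i)
      have hY := binomialOp_indGe_le (hq0 k) (hqε k) (hqε i) hε n j (h1 k) (h2 k)
      have hd : ∀ m, 0 ≤ indGe j (m + 1) - indGe j m :=
        fun m => sub_nonneg.2 (indGe_mono j (Nat.le_succ m))
      have hY0 := binomialOp_nonneg hw.le (div_nonneg (hq0 k) hu.le) n hd 0
      have hXY := mul_le_mul hX hY hY0
        (mul_nonneg (by positivity) (tailDensity_nonneg j (ha i)))
      have hN : 0 ≤ (n : ℝ) * (q i * q k) :=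
        mul_nonneg (Nat.cast_nonneg n) (mul_nonneg (hq0 i) (hq0 k))
      have h' := h.trans (mul_le_mul_of_nonneg_left hXY hN)
      rw [← le_div_iff₀' (mul_pos hu hw), div_eq_inv_mul] at h'
      refine h'.trans ?_
      have hinv : ((1 - q i) * (1 - q k))⁻¹ ≤ ((1 - ε) ^ 2)⁻¹ := by
        refine inv_anti₀ (by positivity) ?_
        rw [sq]
        exact mul_le_mul (by linarith [hqε i]) (by linarith [hqε k]) hv.le hu.le
      refine (mul_le_mul_of_nonneg_right hinv ?_).trans (le_of_eq ?_)
      · have := tailDensity_nonneg j (ha i)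
        have := tailDensity_nonneg j (ha k)
        positivity
      · simp only [ht]; ring
  have hs := Finset.sum_le_sum fun i (_ : i ∈ Finset.univ) =>
    Finset.sum_le_sum fun k (_ : k ∈ Finset.univ) => hpair i k
  have e1 : ∑ i, ∑ k, π i * π k = (∑ i, π i) ^ 2 := by rw [sq, Finset.sum_mul_sum]
  have e2 : ∑ i, ∑ k, n * (((1 - ε) ^ 2)⁻¹ * B ^ 2) * (t i * t k)
      = n * (((1 - ε) ^ 2)⁻¹ * B ^ 2) * (∑ i, t i) ^ 2 := by
    rw [sq (∑ i, t i), Finset.sum_mul_sum]; simp only [Finset.mul_sum]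
  have e3 : ∑ i, ∑ k, multinomialExp q n (fun x => indGe j (x i) * indGe j (x k))
      = multinomialExp q n (fun x => (countGe j x : ℝ) ^ 2) := by
    simp only [← multinomialExp_sum]
    congr 1
    funext x
    rw [cast_countGe, sq, Finset.sum_mul_sum]
  simp only [Finset.sum_sub_distrib, Finset.sum_add_distrib] at hs
  rw [e1, e2, e3] at hs
  simp only [Finset.sum_ite_eq, Finset.mem_univ, if_true, Finset.sum_sub_distrib] at hs
  rw [multinomialExp_countGe]
  change ∑ i, π i + (∑ i, π i) ^ 2 - _ ≤ ∑ i, π i ^ 2 + _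
  linarith

end Multinomial

/-! ### The tail of the Poisson law as a function of its mean -/

/-- The probability that a Poisson variable of mean `a` is at least `j`. -/
def poissonSF (j : ℕ) (a : ℝ) : ℝ :=
  1 - ∑ l ∈ Finset.range j, a ^ l / (l ! : ℝ) * Real.exp (-a)

theorem poissonTail_eq (j : ℕ) (p x : ℝ) : poissonTail j p x = poissonSF j (p * x) := by
  have h : HasSum (fun l : ℕ => (p * x) ^ l / (l ! : ℝ) * Real.exp (-(p * x))) 1 := by
    have := (NormedSpace.expSeries_div_hasSum_exp (p * x)).mul_right (Real.exp (-(p * x)))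
    rwa [← Real.exp_eq_exp_ℝ, ← Real.exp_add, add_neg_cancel, Real.exp_zero] at this
  have h1 := h.summable.sum_add_tsum_nat_add j
  rw [h.tsum_eq] at h1
  unfold poissonTail poissonSF
  rw [← h1, add_sub_cancel_left]
  exact tsum_congr fun l => by rw [add_comm j l]

theorem poissonSF_sub_succ (j : ℕ) (a : ℝ) :
    poissonSF j a - poissonSF (j + 1) a = tailDensity (j + 1) a := by
  simp only [poissonSF, tailDensity, Finset.sum_range_succ]
  ring

theorem hasDerivAt_tailDensity (j : ℕ) (a : ℝ) :
    HasDerivAt (tailDensity (j + 1)) (tailDensity j a - tailDensity (j + 1) a) a := by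
  have h1 : HasDerivAt (fun a : ℝ => a ^ j / (j ! : ℝ)) (j * a ^ (j - 1) / (j ! : ℝ)) a :=
    (hasDerivAt_pow j a).div_const _
  have h2 : HasDerivAt (fun a : ℝ => Real.exp (-a)) (Real.exp (-a) * -1) a :=
    (hasDerivAt_neg a).exp
  refine (h1.mul h2).congr_deriv ?_
  rcases j with _ | j
  · simp [tailDensity]
  · simp only [tailDensity, Nat.factorial_succ]
    push_cast
    have : (j ! : ℝ) ≠ 0 := by positivity
    field_simp
    ring

/-- The derivatives of the Poisson weights telescope. This is how `m_j'` enters the final bound. -/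
theorem hasDerivAt_poissonSF (j : ℕ) (a : ℝ) : HasDerivAt (poissonSF j) (tailDensity j a) a := by
  induction j with
  | zero =>
    have : poissonSF 0 = fun _ => (1 : ℝ) := by funext a; simp [poissonSF]
    rw [this]
    exact hasDerivAt_const a 1
  | succ j ih =>
    have : poissonSF (j + 1) = fun a => poissonSF j a - tailDensity (j + 1) a := by
      funext a
      rw [← poissonSF_sub_succ, sub_sub_cancel]
    rw [this]
    exact (ih.sub (hasDerivAt_tailDensity j a)).congr_deriv (by ring)

theorem tailDensity_le_one (j : ℕ) {a : ℝ} (ha : 0 ≤ a) : tailDensity j a ≤ 1 := by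
  rcases j with _ | j
  · exact zero_le_one
  · have h := mul_le_mul_of_nonneg_right (Real.pow_div_factorial_le_exp a ha j)
      (Real.exp_pos (-a)).le
    rwa [← Real.exp_add, add_neg_cancel, Real.exp_zero] at h

theorem poissonSF_le_one (j : ℕ) {a : ℝ} (ha : 0 ≤ a) : poissonSF j a ≤ 1 :=
  sub_le_self _ (Finset.sum_nonneg fun l _ => by positivity)

theorem poissonSF_nonneg (j : ℕ) {a : ℝ} (ha : 0 ≤ a) : 0 ≤ poissonSF j a := by
  have h := mul_le_mul_of_nonneg_right (Real.sum_le_exp_of_nonneg ha j) (Real.exp_pos (-a)).le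
  rw [← Real.exp_add, add_neg_cancel, Real.exp_zero, Finset.sum_mul] at h
  exact sub_nonneg.2 h

theorem poissonSF_pos (j : ℕ) {a : ℝ} (ha : 0 < a) : 0 < poissonSF j a := by
  have h1 := poissonSF_sub_succ j a
  have h2 := poissonSF_nonneg (j + 1) ha.le
  have h3 : 0 < tailDensity (j + 1) a := by unfold tailDensity; positivity
  linarith

theorem continuous_poissonSF (j : ℕ) : Continuous (poissonSF j) :=
  continuous_iff_continuousAt.2 fun a => (hasDerivAt_poissonSF j a).continuousAt

theorem continuous_tailDensity (j : ℕ) : Continuous (tailDensity j) := by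
  rcases j with _ | j
  · exact continuous_const
  · exact continuous_iff_continuousAt.2 fun a => (hasDerivAt_tailDensity j a).continuousAt

theorem abs_poissonSF_sub_le (j : ℕ) {a b : ℝ} (ha : 0 ≤ a) (hb : 0 ≤ b) :
    |poissonSF j b - poissonSF j a| ≤ |b - a| := by
  have := (convex_Ici (0 : ℝ)).norm_image_sub_le_of_norm_hasDerivWithin_le (C := 1)
    (f := poissonSF j) (fun x _ => (hasDerivAt_poissonSF j x).hasDerivWithinAt)
    (fun x hx => by
      rw [Real.norm_of_nonneg (tailDensity_nonneg j hx)]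
      exact tailDensity_le_one j hx) (x := a) (y := b) ha hb
  simpa using this

theorem abs_tailDensity_sub_le (j : ℕ) {a b : ℝ} (ha : 0 ≤ a) (hb : 0 ≤ b) :
    |tailDensity j b - tailDensity j a| ≤ |b - a| := by
  rcases j with _ | j
  · simp [tailDensity]
  have := (convex_Ici (0 : ℝ)).norm_image_sub_le_of_norm_hasDerivWithin_le (C := 1)
    (f := tailDensity (j + 1)) (fun x _ => (hasDerivAt_tailDensity j x).hasDerivWithinAt)
    (fun x hx => by
      rw [Real.norm_eq_abs, abs_le]
      have h1 := tailDensity_nonneg j hx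
      have h2 := tailDensity_nonneg (j + 1) hx
      have h3 := tailDensity_le_one j hx
      have h4 := tailDensity_le_one (j + 1) hx
      constructor <;> linarith) (x := a) (y := b) ha hb
  simpa using this

/-- Mean value inequality on `[a, a + q]` after removing the linear part: the density is
1-Lipschitz, so the remaining derivative is at most `q`. -/
theorem abs_poissonSF_add_sub_le (j : ℕ) {a q : ℝ} (ha : 0 ≤ a) (hq : 0 ≤ q) :
    |poissonSF j (a + q) - poissonSF j a - q * tailDensity j a| ≤ q ^ 2 := by
  have := (convex_Icc a (a + q)).norm_image_sub_le_of_norm_hasDerivWithin_le (C := q)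
    (f := fun t => poissonSF j t - t * tailDensity j a)
    (f' := fun t => tailDensity j t - 1 * tailDensity j a)
    (fun x _ => ((hasDerivAt_poissonSF j x).sub
      ((hasDerivAt_id x).mul_const _)).hasDerivWithinAt)
    (fun x hx => by
      rw [one_mul, Real.norm_eq_abs]
      refine (abs_tailDensity_sub_le j ha (ha.trans hx.1)).trans ?_
      rw [abs_of_nonneg (by linarith [hx.1])]
      linarith [hx.2]) (x := a) (y := a + q) ⟨le_rfl, by linarith⟩ ⟨by linarith, le_rfl⟩
  rw [Real.norm_eq_abs, Real.norm_eq_abs, add_sub_cancel_left, abs_of_nonneg hq, ← sq] at this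
  refine le_trans (le_of_eq ?_) this
  congr 1
  ring

/-- Le Cam's comparison of the tails of the binomial and Poisson laws. -/
theorem abs_binomialOp_sub_poissonSF_le {q : ℝ} (hq0 : 0 ≤ q) (hq1 : q ≤ 1) (n j : ℕ) :
    |binomialOp (1 - q) q n (indGe j) 0 - poissonSF j (n * q)| ≤ n * q ^ 2 := by
  induction n generalizing j with
  | zero =>
    rcases j with _ | j <;> simp [binomialOp, indGe, poissonSF, Finset.sum_range_succ']
  | succ n ih =>
    have hT := abs_poissonSF_add_sub_le j (mul_nonneg (Nat.cast_nonneg (α := ℝ) n) hq0) hq0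
    have e : ((n + 1 : ℕ) : ℝ) * q = n * q + q := by push_cast; ring
    rw [e, binomialOp, ← binomialOp_shift]
    -- A success lowers the threshold from `j` to `i = j - 1` (truncated at `0`). Since the tails at
    -- `i` and `j` differ by the density, the expansion `hT` reproduces the binomial recursion up to
    -- `q ^ 2`.
    obtain ⟨i, hi, hd⟩ : ∃ i, (fun m => indGe j (m + 1)) = indGe i ∧
        ∀ a, poissonSF i a - poissonSF j a = tailDensity j a := by
      rcases j with _ | j
      · exact ⟨0, by funext m; simp [indGe], fun a => by simp [tailDensity]⟩
      · exact ⟨j, by funext m; simp [indGe], poissonSF_sub_succ j⟩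
    rw [hi]
    rw [← hd] at hT
    have hj := ih j
    have hi' := ih i
    rw [abs_le] at hj hi' hT ⊢
    have h1q : 0 ≤ 1 - q := by linarith
    have a1 := mul_le_mul_of_nonneg_left hj.1 h1q
    have a2 := mul_le_mul_of_nonneg_left hj.2 h1q
    have a3 := mul_le_mul_of_nonneg_left hi'.1 hq0
    have a4 := mul_le_mul_of_nonneg_left hi'.2 hq0
    push_cast
    constructor
    · linarith [hT.1, hT.2]
    · linarith [hT.1, hT.2]

/-! ### The law of the number of colors drawn at least `j` times -/

theorem sampled_cons {n K : ℕ} (k : Fin K) (c : Fin n → Fin K) :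
    sampled (Fin.cons k c : Fin (n + 1) → Fin K) = sampled c + Pi.single k 1 := by
  funext i
  simp only [sampled, Finset.card_filter, Fin.sum_univ_succ, Fin.cons_zero, Fin.cons_succ,
    Pi.add_apply, Pi.single_apply]
  rw [add_comm]
  congr 1
  simp only [eq_comm]

theorem sum_prod_mul_sampled {K : ℕ} (q : Fin K → ℝ) (n : ℕ) (G : (Fin K → ℕ) → ℝ) :
    ∑ c : Fin n → Fin K, (∏ l, q (c l)) * G (sampled c) = multinomialExp q n G := by
  induction n generalizing G with
  | zero =>
    have : sampled (default : Fin 0 → Fin K) = 0 := by funext i; simp [sampled]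
    simp [multinomialExp, this]
  | succ n ih =>
    rw [multinomialExp_succ, ← (Fin.consEquiv fun _ => Fin K).sum_comp, Fintype.sum_prod_type]
    refine Finset.sum_congr rfl fun k _ => ?_
    rw [← ih, Finset.mul_sum]
    refine Finset.sum_congr rfl fun c _ => ?_
    have h : (Fin.consEquiv fun _ => Fin K) (k, c) = Fin.cons k c := rfl
    rw [h, sampled_cons, Fin.prod_univ_succ, mul_assoc]
    simp only [Fin.cons_zero, Fin.cons_succ]

theorem colorLaw_singleton {K : ℕ} (w : Fin K → ℝ) (k : Fin K) :
    colorLaw w {k} = ENNReal.ofReal (w k / totalBalls w) := by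
  simp [colorLaw, Measure.finsetSum_apply, Set.indicator_apply]

theorem sum_div_totalBalls {K : ℕ} {w : Fin K → ℝ} (hV : 0 < totalBalls w) :
    ∑ k, w k / totalBalls w = 1 := by
  rw [← Finset.sum_div]
  exact div_self hV.ne'

theorem isProbabilityMeasure_colorLaw {K : ℕ} {w : Fin K → ℝ} (hw : ∀ k, 0 ≤ w k)
    (hV : 0 < totalBalls w) : IsProbabilityMeasure (colorLaw w) := by
  constructor
  simp only [colorLaw, Measure.finsetSum_apply, Measure.smul_apply, measure_univ, smul_eq_mul,
    mul_one]
  rw [← ENNReal.ofReal_sum_of_nonneg fun k _ => div_nonneg (hw k) hV.le, sum_div_totalBalls hV,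
    ENNReal.ofReal_one]

theorem isProbabilityMeasure_drawLaw {K : ℕ} {w : Fin K → ℝ} (hw : ∀ k, 0 ≤ w k)
    (hV : 0 < totalBalls w) (n : ℕ) : IsProbabilityMeasure (drawLaw w n) := by
  have := isProbabilityMeasure_colorLaw hw hV
  unfold drawLaw
  infer_instance

theorem integral_drawLaw {K : ℕ} {w : Fin K → ℝ} (hw : ∀ k, 0 ≤ w k) (hV : 0 < totalBalls w)
    (n : ℕ) (G : (Fin K → ℕ) → ℝ) :
    ∫ c, G (sampled c) ∂(drawLaw w n) = multinomialExp (fun k => w k / totalBalls w) n G := by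
  have := isProbabilityMeasure_colorLaw hw hV
  have := isProbabilityMeasure_drawLaw hw hV n
  rw [integral_fintype (Integrable.of_finite), ← sum_prod_mul_sampled]
  refine Finset.sum_congr rfl fun c _ => ?_
  rw [smul_eq_mul, Measure.real, drawLaw, Measure.pi_singleton, ENNReal.toReal_prod]
  congr 1
  refine Finset.prod_congr rfl fun l _ => ?_
  rw [colorLaw_singleton, ENNReal.toReal_ofReal (div_nonneg (hw _) hV.le)]

theorem WplusMean_eq {K : ℕ} {w : Fin K → ℝ} (hw : ∀ k, 0 ≤ w k) (hV : 0 < totalBalls w) (p : ℝ)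
    (j : ℕ) :
    WplusMean w p j = multinomialExp (fun k => w k / totalBalls w) (numDraws w p)
      fun x => (countGe j x : ℝ) :=
  integral_drawLaw hw hV _ fun x => (countGe j x : ℝ)

theorem WplusLaw_real {K : ℕ} {w : Fin K → ℝ} (hw : ∀ k, 0 ≤ w k) (hV : 0 < totalBalls w) (p : ℝ)
    (j : ℕ) (A : Set ℕ) :
    (WplusLaw w p j).real A = multinomialExp (fun k => w k / totalBalls w) (numDraws w p)
      fun x => A.indicator (1 : ℕ → ℝ) (countGe j x) := by
  rw [← integral_drawLaw hw hV _ fun x => A.indicator (1 : ℕ → ℝ) (countGe j x),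
    ← integral_indicator_one MeasurableSet.of_discrete, WplusLaw,
    integral_map (Measurable.of_discrete.aemeasurable)
      (Measurable.of_discrete.aestronglyMeasurable)]
  rfl

theorem tvDist_nonneg (μ ν : Measure ℕ) : 0 ≤ tvDist μ ν :=
  Real.iSup_nonneg fun _ => abs_nonneg _

/-! ### The limit for a deterministic environment -/

/-- Differences of convergent averages give `u n / n → 0`; the maximum then comes either from a
fixed initial segment or from late terms `u i ≤ (ε / 2) i`. Hence no color keeps a positive share of
the balls. -/
theorem tendsto_partialSups_div {u : ℕ → ℝ} (hu : ∀ i, 0 ≤ u i) {e : ℝ}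
    (h : Tendsto (fun n : ℕ => (∑ i ∈ Finset.range n, u i) / n) atTop (nhds e)) :
    Tendsto (fun n : ℕ => partialSups u n / n) atTop (nhds 0) := by
  have h1 : Tendsto (fun n : ℕ => u n / n) atTop (nhds 0) := by
    have hs := (tendsto_add_atTop_iff_nat 1).2 h
    have hr : Tendsto (fun n : ℕ => 1 + 1 / (n : ℝ)) atTop (nhds (1 + 0)) :=
      tendsto_const_nhds.add tendsto_one_div_atTop_nhds_zero_nat
    have := (hs.mul hr).sub h
    rw [add_zero, mul_one, sub_self] at this
    refine this.congr' ?_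
    filter_upwards [eventually_gt_atTop 0] with n hn
    have hn' : (n : ℝ) ≠ 0 := by positivity
    have hn'' : (n : ℝ) + 1 ≠ 0 := by positivity
    rw [Finset.sum_range_succ]
    push_cast
    field_simp
    ring
  have h0 : ∀ n, 0 ≤ partialSups u n := fun n => (hu n).trans (le_partialSups u n)
  rw [Metric.tendsto_atTop]
  intro ε hε
  obtain ⟨N, hN⟩ := eventually_atTop.1 (h1.eventually (gt_mem_nhds (half_pos hε)))
  have h2 : Tendsto (fun n : ℕ => partialSups u N / n) atTop (nhds 0) :=
    tendsto_const_div_atTop_nhds_zero_nat _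
  obtain ⟨M, hM⟩ := eventually_atTop.1 (h2.eventually (gt_mem_nhds (half_pos hε)))
  refine ⟨max M (N + 1), fun n hn => ?_⟩
  have hnM : M ≤ n := le_of_max_le_left hn
  have hnN : N + 1 ≤ n := le_of_max_le_right hn
  have hn0 : (0 : ℝ) < n := by
    have : 0 < n := by omega
    exact_mod_cast this
  rw [Real.dist_eq, sub_zero, abs_of_nonneg (div_nonneg (h0 n) hn0.le), div_lt_iff₀ hn0]
  have hb := hM n hnM
  rw [div_lt_iff₀ hn0] at hb
  have key : partialSups u n ≤ max (partialSups u N) (ε / 2 * n) := by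
    refine partialSups_le u n _ fun i hi => ?_
    rcases le_or_gt i N with hiN | hiN
    · exact le_max_of_le_left (le_partialSups_of_le u hiN)
    · refine le_max_of_le_right ?_
      have hi0 : (0 : ℝ) < i := by
        have : 0 < i := by omega
        exact_mod_cast this
      have := hN i hiN.le
      rw [div_lt_iff₀ hi0] at this
      have hin : (i : ℝ) ≤ n := by exact_mod_cast hi
      nlinarith
  refine key.trans_lt (max_lt ?_ ?_) <;> nlinarith

/-- The constant by which the covariance bound exceeds its limit when all color probabilities are
at most `ε`. -/
def covFactor (j : ℕ) (ε : ℝ) : ℝ :=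
  ((1 - ε) ^ 2)⁻¹ * (Real.exp ε * (((1 - ε) ^ 2)⁻¹) ^ j) ^ 2

theorem tendsto_covFactor (j : ℕ) {ι : Type*} {l : Filter ι} {f : ι → ℝ}
    (hf : Tendsto f l (nhds 0)) : Tendsto (fun x => covFactor j (f x)) l (nhds 1) := by
  have : ContinuousAt (covFactor j) 0 := by
    unfold covFactor
    have h : ContinuousAt (fun ε : ℝ => ((1 - ε) ^ 2)⁻¹) 0 :=
      ContinuousAt.inv₀ (by fun_prop) (by norm_num)
    exact h.mul ((Real.continuous_exp.continuousAt.mul (h.pow j)).pow 2)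
  have h1 : covFactor j 0 = 1 := by simp [covFactor]
  rw [← h1]
  exact this.tendsto.comp hf

/-- The non-asymptotic bound of the total variation distance. -/
theorem tvDist_le {K : ℕ} {w : Fin K → ℝ} (hw : ∀ k, 0 ≤ w k) (hV : 0 < totalBalls w) {p : ℝ}
    (hp : 0 < p) (j : ℕ) {ε : ℝ} (hε : ε < 1) (hwε : ∀ k, w k / totalBalls w ≤ ε)
    (hpos : 0 < ∑ k, poissonSF j (p * w k) - (p * ε * totalBalls w + 1)) :
    tvDist (WplusLaw w p j) (poissonMeasure (WplusMean w p j).toNNReal)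
      ≤ (∑ k, poissonSF j (p * w k) ^ 2 + 2 * (p * ε * totalBalls w + 1)
          + covFactor j ε * (p / totalBalls w) * (∑ k, w k * tailDensity j (p * w k)) ^ 2)
        / (∑ k, poissonSF j (p * w k) - (p * ε * totalBalls w + 1)) := by
  set V := totalBalls w with hVdef
  set q : Fin K → ℝ := fun k => w k / V with hq
  set n := numDraws w p with hn
  have hpV : 0 ≤ p * V := by positivity
  have hnle : (n : ℝ) ≤ p * V := Nat.floor_le hpV
  have hnlt : p * V < n + 1 := Nat.lt_floor_add_one _
  have hq0 : ∀ k, 0 ≤ q k := fun k => div_nonneg (hw k) hV.le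
  have hq1 : ∑ k, q k = 1 := sum_div_totalBalls hV
  have hwq : ∀ k, w k = V * q k := fun k => by simp only [hq]; field_simp
  have h1 : ∀ k, n * q k ≤ p * w k := fun k => by
    rw [hwq k, ← mul_assoc]
    exact mul_le_mul_of_nonneg_right hnle (hq0 k)
  have h2 : ∀ k, p * w k ≤ n * q k + q k := fun k => by
    rw [hwq k, ← mul_assoc]
    nlinarith [mul_le_mul_of_nonneg_right hnlt.le (hq0 k)]
  have hpw : ∀ k, 0 ≤ p * w k := fun k => mul_nonneg hp.le (hw k)
  set π : Fin K → ℝ := fun k => multinomialExp q n (fun x => indGe j (x k)) with hπ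
  -- `n * q k ^ 2` is Le Cam's error; `q k` pays for the integer part, which moves the mean from `p
  -- * w k` to `n * q k`.
  have hπX : ∀ k, |π k - poissonSF j (p * w k)| ≤ n * q k ^ 2 + q k := fun k => by
    have e : π k = binomialOp (1 - q k) (q k) n (indGe j) 0 := multinomialExp_apply hq1 k n _
    have a1 := abs_binomialOp_sub_poissonSF_le (hq0 k) ((hwε k).trans hε.le) n j
    have hnq : 0 ≤ n * q k := mul_nonneg (Nat.cast_nonneg n) (hq0 k)
    have a2 := abs_poissonSF_sub_le j (hpw k) hnq
    rw [abs_of_nonpos (by linarith [h1 k] : n * q k - p * w k ≤ 0)] at a2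
    rw [← e] at a1
    have := abs_sub_le (π k) (poissonSF j (n * q k)) (poissonSF j (p * w k))
    linarith [h2 k]
  have herr : ∑ k, (n * q k ^ 2 + q k) ≤ p * ε * V + 1 := by
    rw [Finset.sum_add_distrib, hq1]
    have hε0 : n * ε ≤ p * V * ε := by
      obtain ⟨k⟩ : Nonempty (Fin K) := by
        by_contra hne
        rw [not_nonempty_iff] at hne
        simp at hq1
      exact mul_le_mul_of_nonneg_right hnle ((hq0 k).trans (hwε k))
    have : ∑ k, (n : ℝ) * q k ^ 2 ≤ ∑ k, n * ε * q k := Finset.sum_le_sum fun k _ => by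
      rw [sq, mul_assoc]
      exact mul_le_mul_of_nonneg_left (mul_le_mul_of_nonneg_right (hwε k) (hq0 k))
        (Nat.cast_nonneg n)
    rw [← Finset.mul_sum Finset.univ q (n * ε), hq1] at this
    linarith
  have hmean : WplusMean w p j = ∑ k, π k := by
    rw [WplusMean_eq hw hV, multinomialExp_countGe]
  have hlow : ∑ k, poissonSF j (p * w k) - (p * ε * V + 1) ≤ ∑ k, π k := by
    have : ∑ k, (poissonSF j (p * w k) - π k) ≤ ∑ k, (n * q k ^ 2 + q k) :=
      Finset.sum_le_sum fun k _ => by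
        have := (abs_le.1 (hπX k)).1
        linarith
    rw [Finset.sum_sub_distrib] at this
    linarith
  -- Squaring is 2-Lipschitz on `[0, 1]`, hence the factor `2`.
  have hsq : ∑ k, π k ^ 2 ≤ ∑ k, poissonSF j (p * w k) ^ 2 + 2 * (p * ε * V + 1) := by
    have : ∑ k, (π k ^ 2 - poissonSF j (p * w k) ^ 2) ≤ ∑ k, 2 * (n * q k ^ 2 + q k) :=
      Finset.sum_le_sum fun k _ => by
        have a1 := (abs_le.1 (hπX k)).2
        have a2 := poissonSF_nonneg j (hpw k)
        have a3 := poissonSF_le_one j (hpw k)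
        have a4 : π k ≤ 1 := by
          rw [← multinomialExp_const hq1 n (1 : ℝ)]
          exact multinomialExp_mono hq0 n fun x => indGe_le_one _ _
        have a5 : 0 ≤ π k := by
          rw [← multinomialExp_const hq1 n (0 : ℝ)]
          exact multinomialExp_mono hq0 n fun x => indGe_nonneg _ _
        have a6 : 0 ≤ n * q k ^ 2 + q k := (abs_nonneg _).trans (hπX k)
        nlinarith
    rw [Finset.sum_sub_distrib, ← Finset.mul_sum] at this
    linarith
  -- Positivity makes the truncation in `toNNReal` harmless and allows division by the Poisson mean.
  have hmpos : 0 < WplusMean w p j := by rw [hmean]; linarith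
  have hr : ((WplusMean w p j).toNNReal : ℝ) = WplusMean w p j := Real.coe_toNNReal _ hmpos.le
  have hvar := variance_defect_le hq0 hq1 hε hwε n j h1 h2
  have hcov : n * (((1 - ε) ^ 2)⁻¹ * (Real.exp ε * (((1 - ε) ^ 2)⁻¹) ^ j) ^ 2)
          * (∑ k, q k * tailDensity j (p * w k)) ^ 2
      ≤ covFactor j ε * (p / V) * (∑ k, w k * tailDensity j (p * w k)) ^ 2 := by
    have e : ∑ k, q k * tailDensity j (p * w k) = (∑ k, w k * tailDensity j (p * w k)) / V := by
      rw [Finset.sum_div]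
      exact Finset.sum_congr rfl fun k _ => by simp only [hq]; ring
    rw [e]
    have hc : 0 ≤ covFactor j ε := by unfold covFactor; positivity
    change n * covFactor j ε * _ ≤ _
    calc n * covFactor j ε * ((∑ k, w k * tailDensity j (p * w k)) / V) ^ 2
        ≤ p * V * covFactor j ε * ((∑ k, w k * tailDensity j (p * w k)) / V) ^ 2 := by gcongr
      _ = _ := by field_simp
  have hXnn : 0 ≤ ∑ k, π k ^ 2 := Finset.sum_nonneg fun k _ => sq_nonneg _
  have hCnn : 0 ≤ covFactor j ε * (p / V) * (∑ k, w k * tailDensity j (p * w k)) ^ 2 := by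
    have hc : 0 ≤ covFactor j ε := by unfold covFactor; positivity
    positivity
  refine ciSup_le fun A => ?_
  rw [WplusLaw_real hw hV]
  refine (multinomialExp_indicator_sub_le hq0 hq1 n j (Real.toNNReal_pos.2 hmpos)
    (by rw [hr, WplusMean_eq hw hV]) A).trans ?_
  rw [hr]
  rw [← WplusMean_eq hw hV] at hvar
  refine div_le_div₀ (by linarith) (by linarith) hpos (by rw [hmean]; exact hlow)

/-- Take `ε` to be the largest of `u 0, …, u K` over the sum of the first `K` terms, and divide
numerator and denominator of `tvDist_le` by `K`. The error `p ε V + 1` is `o(K)`, and the covariance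
factor tends to `1`. -/
theorem limsup_tvDist_le {u : ℕ → ℝ} (hu : ∀ i, 0 ≤ u i) {p : ℝ} (hp : 0 < p) (j : ℕ)
    {e m m₂ d : ℝ} (he : 0 < e) (hm : 0 < m)
    (hE : Tendsto (fun n : ℕ => (∑ i ∈ Finset.range n, u i) / n) atTop (nhds e))
    (hM : Tendsto (fun n : ℕ => (∑ i ∈ Finset.range n, poissonSF j (p * u i)) / n) atTop (nhds m))
    (hM₂ : Tendsto (fun n : ℕ => (∑ i ∈ Finset.range n, poissonSF j (p * u i) ^ 2) / n) atTop
      (nhds m₂))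
    (hD : Tendsto (fun n : ℕ => (∑ i ∈ Finset.range n, u i * tailDensity j (p * u i)) / n) atTop
      (nhds d)) :
    limsup (fun K : ℕ => tvDist (WplusLaw (fun i : Fin K => u i) p j)
        (poissonMeasure (WplusMean (fun i : Fin K => u i) p j).toNNReal)) atTop
      ≤ m₂ / m + p / e * (d ^ 2 / m) := by
  set S : ℕ → ℝ := fun n => ∑ i ∈ Finset.range n, u i
  set ε : ℕ → ℝ := fun n => partialSups u n / S n
  have hεlim : Tendsto ε atTop (nhds 0) := by
    have := (tendsto_partialSups_div hu hE).div hE he.ne'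
    rw [zero_div] at this
    refine this.congr' ?_
    filter_upwards [eventually_gt_atTop 0] with n hn
    have hn' : (n : ℝ) ≠ 0 := by positivity
    exact div_div_div_cancel_right₀ hn' _ _
  have hinv : Tendsto (fun n : ℕ => 1 / (n : ℝ)) atTop (nhds 0) :=
    tendsto_one_div_atTop_nhds_zero_nat
  have herr : Tendsto (fun n : ℕ => p * ε n * (S n / n) + 1 / (n : ℝ)) atTop (nhds 0) := by
    have := ((hεlim.const_mul p).mul hE).add hinv
    simpa using this
  set N : ℕ → ℝ := fun n => (∑ i ∈ Finset.range n, poissonSF j (p * u i) ^ 2) / n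
    + 2 * (p * ε n * (S n / n) + 1 / (n : ℝ))
    + covFactor j (ε n) * (p / (S n / n))
      * ((∑ i ∈ Finset.range n, u i * tailDensity j (p * u i)) / n) ^ 2
  set D : ℕ → ℝ := fun n => (∑ i ∈ Finset.range n, poissonSF j (p * u i)) / n
    - (p * ε n * (S n / n) + 1 / (n : ℝ))
  have hNlim : Tendsto N atTop (nhds (m₂ + 2 * 0 + 1 * (p / e) * d ^ 2)) :=
    (hM₂.add (herr.const_mul 2)).add
      (((tendsto_covFactor j hεlim).mul (tendsto_const_nhds.div hE he.ne')).mul (hD.pow 2))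
  have hDlim : Tendsto D atTop (nhds (m - 0)) := hM.sub herr
  have hlim : Tendsto (fun n => N n / D n) atTop (nhds (m₂ / m + p / e * (d ^ 2 / m))) := by
    have := hNlim.div hDlim (by rw [sub_zero]; exact hm.ne')
    have h : m₂ / m + p / e * (d ^ 2 / m) = (m₂ + 2 * 0 + 1 * (p / e) * d ^ 2) / (m - 0) := by
      rw [sub_zero]; ring
    rw [h]
    exact this
  rw [← hlim.limsup_eq]
  refine limsup_le_limsup ?_ (isCoboundedUnder_le_of_le atTop (x := 0) fun K => tvDist_nonneg _ _)
    hlim.isBoundedUnder_le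
  rw [sub_zero] at hDlim
  filter_upwards [hE.eventually (lt_mem_nhds he), hεlim.eventually (gt_mem_nhds one_pos),
    hDlim.eventually (lt_mem_nhds hm), eventually_gt_atTop 0] with K hK1 hK2 hK3 hK4
  have hK : (0 : ℝ) < K := by positivity
  have hS : 0 < S K := by
    have := mul_pos hK1 hK
    rwa [div_mul_cancel₀ _ hK.ne'] at this
  have hV : totalBalls (fun i : Fin K => u i) = S K := by
    simp only [totalBalls, S, Finset.sum_range]
  have hDK : ∑ i ∈ Finset.range K, poissonSF j (p * u i) - (p * ε K * S K + 1) = D K * K := by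
    simp only [D]
    field_simp
  have h := tvDist_le (w := fun i : Fin K => u i) (fun k => hu k) (by rw [hV]; exact hS) hp j
    (ε := ε K) hK2 (fun k => by
      rw [hV]
      exact div_le_div_of_nonneg_right (le_partialSups_of_le u k.2.le) hS.le)
    (by
      rw [hV, ← Finset.sum_range fun i => poissonSF j (p * u i), hDK]
      exact mul_pos hK3 hK)
  refine h.trans (le_of_eq ?_)
  rw [hV, ← Finset.sum_range fun i => poissonSF j (p * u i),
    ← Finset.sum_range fun i => poissonSF j (p * u i) ^ 2,
    ← Finset.sum_range fun i => u i * tailDensity j (p * u i), hDK, mul_comm (D K), ← div_div]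
  congr 1
  simp only [N]
  field_simp

/-! ### Moments of the Poisson tail of a random mean -/

section Moments

variable {Ω : Type*} [MeasurableSpace Ω] {μ : Measure Ω} {X : Ω → ℝ}

theorem tailMoment_eq (r j : ℕ) (p : ℝ) :
    tailMoment μ X r j p = ∫ ω, poissonSF j (p * X ω) ^ r ∂μ := by
  simp only [tailMoment, poissonTail_eq]

theorem integrable_poissonSF_pow [IsProbabilityMeasure μ] (hX : AEMeasurable X μ)
    (h0 : ∀ᵐ ω ∂μ, 0 ≤ X ω) {p : ℝ} (hp : 0 ≤ p) (r j : ℕ) :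
    Integrable (fun ω => poissonSF j (p * X ω) ^ r) μ := by
  refine Integrable.of_bound (C := 1) ?_ ?_
  · exact (((continuous_poissonSF j).measurable.comp_aemeasurable (hX.const_mul p)).pow_const
      r).aestronglyMeasurable
  · filter_upwards [h0] with ω hω
    have ha := mul_nonneg hp hω
    rw [norm_pow, Real.norm_of_nonneg (poissonSF_nonneg j ha)]
    exact pow_le_one₀ (poissonSF_nonneg j ha) (poissonSF_le_one j ha)

theorem aestronglyMeasurable_mul_tailDensity (hX : AEMeasurable X μ) (p : ℝ) (j : ℕ) :
    AEStronglyMeasurable (fun ω => X ω * tailDensity j (p * X ω)) μ :=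
  (hX.mul ((continuous_tailDensity j).measurable.comp_aemeasurable
    (hX.const_mul p))).aestronglyMeasurable

/-- Differentiation under the integral, with `X` itself as dominating function because the density
is at most `1`. -/
theorem hasDerivAt_tailMoment [IsProbabilityMeasure μ] (hX : Integrable X μ)
    (h0 : ∀ᵐ ω ∂μ, 0 ≤ X ω) {p : ℝ} (hp : 0 < p)
    (j : ℕ) :
    Integrable (fun ω => X ω * tailDensity j (p * X ω)) μ ∧
      HasDerivAt (tailMoment μ X 1 j) (∫ ω, X ω * tailDensity j (p * X ω) ∂μ) p := by
  have hm := hX.aestronglyMeasurable.aemeasurable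
  have e : tailMoment μ X 1 j = fun p => ∫ ω, poissonSF j (p * X ω) ∂μ := by
    funext p
    simp only [tailMoment_eq, pow_one]
  rw [e]
  refine hasDerivAt_integral_of_dominated_loc_of_deriv_le (s := Set.Ioi 0)
    (F := fun p ω => poissonSF j (p * X ω)) (F' := fun p ω => X ω * tailDensity j (p * X ω))
    (bound := X) (Ioi_mem_nhds hp) ?_ ?_ (aestronglyMeasurable_mul_tailDensity hm p j) ?_ hX ?_
  · exact Eventually.of_forall fun p => ((continuous_poissonSF j).measurable.comp_aemeasurable
      (hm.const_mul p)).aestronglyMeasurable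
  · simpa using integrable_poissonSF_pow hm h0 hp.le 1 j
  · filter_upwards [h0] with ω hω p' hp'
    have ha := mul_nonneg (le_of_lt hp') hω
    rw [norm_mul, Real.norm_of_nonneg hω, Real.norm_of_nonneg (tailDensity_nonneg j ha)]
    exact mul_le_of_le_one_right hω (tailDensity_le_one j ha)
  · refine Eventually.of_forall fun ω p' _ => ?_
    rw [mul_comm (X ω)]
    exact HasDerivAt.comp (h₂ := poissonSF j) p' (hasDerivAt_poissonSF j (p' * X ω))
      (hasDerivAt_mul_const (X ω))

/-- The Poisson tail is positive wherever `X` is, and a positive mean makes that set non-null. -/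
theorem tailMoment_one_pos [IsProbabilityMeasure μ] (hX : Integrable X μ)
    (h0 : ∀ᵐ ω ∂μ, 0 ≤ X ω) (hpos : 0 < ∫ ω, X ω ∂μ)
    {p : ℝ} (hp : 0 < p) (j : ℕ) : 0 < tailMoment μ X 1 j p := by
  have hm := hX.aestronglyMeasurable.aemeasurable
  have hnn : ∀ᵐ ω ∂μ, 0 ≤ poissonSF j (p * X ω) ^ 1 := by
    filter_upwards [h0] with ω hω
    exact pow_nonneg (poissonSF_nonneg j (mul_nonneg hp.le hω)) 1
  rw [tailMoment_eq, integral_pos_iff_support_of_nonneg_ae hnn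
    (integrable_poissonSF_pow hm h0 hp.le 1 j)]
  rw [integral_pos_iff_support_of_nonneg_ae h0 hX] at hpos
  refine hpos.trans_le (measure_mono_ae ?_)
  filter_upwards [h0] with ω hω hne
  have hω' : 0 < X ω := lt_of_le_of_ne hω (Ne.symm hne)
  exact (pow_pos (poissonSF_pos j (mul_pos hp hω')) 1).ne'

end Moments

/-- The strong law of large numbers for a measurable function of i.i.d. random variables. -/
theorem strong_law_comp {Ω : Type*} [MeasurableSpace Ω] {μ : Measure Ω} {v : ℕ → Ω → ℝ}
    (hindep : iIndepFun v μ) (hident : ∀ i, IdentDistrib (v i) (v 0) μ μ) {g : ℝ → ℝ}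
    (hg : Measurable g) (hint : Integrable (fun ω => g (v 0 ω)) μ) :
    ∀ᵐ ω ∂μ, Tendsto (fun n : ℕ => (∑ i ∈ Finset.range n, g (v i ω)) / n) atTop
      (nhds (∫ ω, g (v 0 ω) ∂μ)) :=
  strong_law_ae_real (fun i ω => g (v i ω)) hint
    (fun _ _ hij => (hindep.indepFun hij).comp hg hg) fun i => (hident i).comp hg

end UrnSampling

end

theorem mainTheorem7 {Ω : Type*} [MeasurableSpace Ω] (μ : Measure Ω) [IsProbabilityMeasure μ]
    (v : ℕ → Ω → ℝ) (hindep : iIndepFun v μ) (hident : ∀ i, IdentDistrib (v i) (v 0) μ μ)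
    (hnonneg : ∀ᵐ ω ∂μ, 0 ≤ v 0 ω) (hint : Integrable (v 0) μ) (hmean : 0 < ∫ ω, v 0 ω ∂μ)
    (p : ℝ) (hp0 : 0 < p) (hp1 : p < 1) (j : ℕ) :
    0 < UrnSampling.tailMoment μ (v 0) 1 j p ∧
    DifferentiableAt ℝ (UrnSampling.tailMoment μ (v 0) 1 j) p ∧
    ∀ᵐ ω ∂μ,
      limsup (fun K : ℕ =>
          UrnSampling.tvDist
            (UrnSampling.WplusLaw (fun i : Fin K => v i ω) p j)
            (poissonMeasure (UrnSampling.WplusMean (fun i : Fin K => v i ω) p j).toNNReal)) atTop ≤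
        UrnSampling.tailMoment μ (v 0) 2 j p / UrnSampling.tailMoment μ (v 0) 1 j p +
          p / (∫ ω', v 0 ω' ∂μ) *
            (deriv (UrnSampling.tailMoment μ (v 0) 1 j) p ^ 2 /
              UrnSampling.tailMoment μ (v 0) 1 j p) := by
  have hm := hint.aestronglyMeasurable.aemeasurable
  obtain ⟨hdint, hderiv⟩ := UrnSampling.hasDerivAt_tailMoment hint hnonneg hp0 j
  have hpos := UrnSampling.tailMoment_one_pos hint hnonneg hmean hp0 j
  refine ⟨hpos, hderiv.differentiableAt, ?_⟩
  rw [hderiv.deriv]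
  -- From here on there are only countably many almost sure events, so one environment satisfies
  -- nonnegativity and the four strong laws, and the deterministic bound applies to it.
  have hall : ∀ᵐ ω ∂μ, ∀ i, 0 ≤ v i ω := ae_all_iff.2 fun i =>
    (hident i).symm.ae_snd (p := fun x => 0 ≤ x) measurableSet_Ici hnonneg
  have hSF := (UrnSampling.continuous_poissonSF j).measurable
  have hTD := (UrnSampling.continuous_tailDensity j).measurable
  have hE := UrnSampling.strong_law_comp hindep hident (g := fun x => x) measurable_id hint
  have hM := UrnSampling.strong_law_comp hindep hident
    (g := fun x => UrnSampling.poissonSF j (p * x) ^ 1)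
    (by fun_prop) (UrnSampling.integrable_poissonSF_pow hm hnonneg hp0.le 1 j)
  have hM₂ := UrnSampling.strong_law_comp hindep hident
    (g := fun x => UrnSampling.poissonSF j (p * x) ^ 2)
    (by fun_prop) (UrnSampling.integrable_poissonSF_pow hm hnonneg hp0.le 2 j)
  have hD := UrnSampling.strong_law_comp hindep hident
    (g := fun x => x * UrnSampling.tailDensity j (p * x))
    (by fun_prop) hdint
  rw [← UrnSampling.tailMoment_eq] at hM hM₂
  simp only [pow_one] at hM
  filter_upwards [hall, hE, hM, hM₂, hD] with ω h0 h1 h2 h3 h4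
  exact UrnSampling.limsup_tvDist_le h0 hp0 j hmean hpos h1 h2 h3 h4
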